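/- Let $\mathbb{CH}^n$ be complex hyperbolic space, realized as the open unit ball of $\mathbb{C}^n$ with the metric $$\mathbf{c}_n(u,v)=\mathrm{Re}\,\frac{(1-|z|^2)\langle u,v\rangle+\langle u,z\rangle\langle z,v\rangle}{(1-|z|^2)^2}\qquad(u,v\in T_z\mathbb{CH}^n=\mathbb{C}^n),$$ of constant holomorphic sectional curvature $-4$ (here $\langle\cdot,\cdot\rangle$ is the standard Hermitian product, conjugate-linear in the first variable). Let $\mathbb{CH}^2\subset\mathbb{CH}^5$ be the standard totally geodesic copy $\{z_3=z_4=z_5=0\}$, let $S^5\subset\mathbb{C}^3$ be the unit sphere, and let $\mathbf{p}_2$ be the Fubini–Study metric on $\mathbb{CP}^2$ of constant holomorphic sectional curvature $4$, pulled back to $S^5$ by the Hopf fibration. Let $d\theta$ denote the one-form on $\mathbb{CH}^2\times S^5$ $$d\theta_{(q,W)}(u,w)=\mathrm{Im}\langle W,w\rangle+\frac{\mathrm{Im}\langle q,u\rangle}{1-|q|^2},$$ that is, the connection form, with $d\theta(\partial/\partial\theta)=1$ for the generator $\partial/\partial\theta=iW$ of the circle action on $S^5$, which is the sum of the Hopf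 contact form of $S^5$ and of a one-form on $\mathbb{CH}^2$ whose exterior derivative is twice the Kähler form of $\mathbf{c}_2$. Theorem. There is a diffeomorphism $\Phi:(\mathbb{CH}^2\times S^5)\times(0,\infty)\to\mathbb{CH}^5\setminus\mathbb{CH}^2$ such that for all $(q,W,r)$ the distance from $\Phi(q,W,r)$ to $\mathbb{CH}^2$ is $r$ and is attained at $q$, and $$\Phi^*\mathbf{c}_5=\cosh^2(r)\,\mathbf{c}_2+\sinh^2(r)\,\mathbf{p}_2+\tfrac14\sinh^2(2r)\,d\theta^2+dr^2 .$$ In particular, on each sphere $\{q\}\times S^5\times\{r\}$ the induced metric is the Berger metric $\sinh^2(r)\,\mathbf{p}_2+\tfrac14\sinh^2(2r)\,d\theta^2$, where $d\theta$ restricts to the Hopf contact form. -/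

import Mathlib

open scoped Manifold ContDiff

noncomputable section

/-! ### Complex hyperbolic space (ball model) -/

section ComplexHyperbolic

variable {F : Type*} [NormedAddCommGroup F] [InnerProductSpace ℂ F]

/-- The open unit ball of a Hermitian vector space `F`. For `F = ℂⁿ` this open subset, with its
smooth structure, is complex hyperbolic space `ℂℍⁿ`; its tangent space at each point is `F`. -/
def unitBall (F : Type*) [NormedAddCommGroup F] [InnerProductSpace ℂ F] :
    TopologicalSpace.Opens F :=
  ⟨Metric.ball 0 1, Metric.isOpen_ball⟩

theorem unitBall.den_pos (z : unitBall F) : 0 < 1 - ‖(z : F)‖ ^ 2 := by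
  have h : (z : F) ∈ Metric.ball (0 : F) 1 := z.2
  have h1 : ‖(z : F)‖ < 1 := by simpa using h
  nlinarith [norm_nonneg (z : F)]

/-- The real inner product `(u, v) ↦ Re ⟪u, v⟫` on a Hermitian vector space. -/
def realInner (F : Type*) [NormedAddCommGroup F] [InnerProductSpace ℂ F] :
    F →L[ℝ] F →L[ℝ] ℝ :=
  @innerSL ℝ F _ _ InnerProductSpace.complexToReal

theorem realInner_apply (u v : F) : realInner F u v = (inner ℂ u v).re :=
  rfl

theorem realInner_I_smul (u v : F) : realInner F (Complex.I • u) v = (inner ℂ u v).im := by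
  rw [realInner_apply, inner_smul_left]; simp

/-- The bilinear form
`(u, v) ↦ Re ((1 - ‖z‖²) ⟪u, v⟫ + ⟪u, z⟫ ⟪z, v⟫) / (1 - ‖z‖²)²`, see `chForm_apply`. -/
def chForm (z : F) : F →L[ℝ] F →L[ℝ] ℝ :=
  (1 - ‖z‖ ^ 2)⁻¹ • realInner F
    + ((1 - ‖z‖ ^ 2)⁻¹) ^ 2 •
      ((realInner F z).smulRight (realInner F z)
        + (realInner F (Complex.I • z)).smulRight (realInner F (Complex.I • z)))

theorem chForm_eq (z u v : F) :
    chForm z u v = (1 - ‖z‖ ^ 2)⁻¹ * (inner ℂ u v).re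
      + ((1 - ‖z‖ ^ 2)⁻¹) ^ 2 * ((inner ℂ z u).re * (inner ℂ z v).re
        + (inner ℂ z u).im * (inner ℂ z v).im) := by
  simp only [← realInner_I_smul, ← realInner_apply]
  simp [chForm, mul_add]

theorem chForm_apply (z : unitBall F) (u v : F) :
    chForm (z : F) u v
      = (((1 - ‖(z : F)‖ ^ 2 : ℝ) : ℂ) * inner ℂ u v
          + inner ℂ u (z : F) * inner ℂ (z : F) v).re / (1 - ‖(z : F)‖ ^ 2) ^ 2 := by
  have h := (unitBall.den_pos z).ne'
  rw [chForm_eq, ← inner_conj_symm u (z : F)]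
  rw [Complex.add_re, Complex.re_ofReal_mul, Complex.mul_re, Complex.conj_re, Complex.conj_im]
  field_simp
  ring

theorem chForm_symm (z u v : F) : chForm z u v = chForm z v u := by
  rw [chForm_eq, chForm_eq, ← inner_conj_symm u v, Complex.conj_re]
  ring

theorem chForm_self_ge (z : unitBall F) (v : F) : ‖v‖ ^ 2 ≤ chForm (z : F) v v := by
  have h := unitBall.den_pos z
  have hv : (inner ℂ v v).re = ‖v‖ ^ 2 := by
    simpa using inner_self_eq_norm_sq (𝕜 := ℂ) v
  rw [chForm_eq, hv]
  have h1 : 1 ≤ (1 - ‖(z : F)‖ ^ 2)⁻¹ :=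
    (one_le_inv₀ h).2 (by nlinarith [sq_nonneg ‖(z : F)‖])
  have h2 : ‖v‖ ^ 2 ≤ (1 - ‖(z : F)‖ ^ 2)⁻¹ * ‖v‖ ^ 2 :=
    le_mul_of_one_le_left (sq_nonneg _) h1
  have h3 : 0 ≤ ((1 - ‖(z : F)‖ ^ 2)⁻¹) ^ 2 * ((inner ℂ (z : F) v).re * (inner ℂ (z : F) v).re
        + (inner ℂ (z : F) v).im * (inner ℂ (z : F) v).im) :=
    mul_nonneg (sq_nonneg _) (add_nonneg (mul_self_nonneg _) (mul_self_nonneg _))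
  linarith

theorem contDiffOn_smul_aux {E G : Type*} [NormedAddCommGroup E] [NormedSpace ℝ E]
    [NormedAddCommGroup G] [NormedSpace ℝ G] {s : Set E} {f : E → ℝ} {g : E → G}
    (hf : ContDiffOn ℝ ∞ f s) (hg : ContDiffOn ℝ ∞ g s) :
    ContDiffOn ℝ ∞ (fun x ↦ f x • g x) s := hf.smul hg

theorem contDiffOn_chForm : ContDiffOn ℝ ∞ (fun z : F ↦ chForm z) (Metric.ball 0 1) := by
  have hI : ContDiff ℝ ∞ (fun z : F ↦ realInner F (Complex.I • z)) :=
    (realInner F).contDiff.comp (contDiff_const_smul (R := ℂ) Complex.I)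
  have hr : ContDiff ℝ ∞ (fun z : F ↦ realInner F z) := (realInner F).contDiff
  have hd : ContDiffOn ℝ ∞ (fun z : F ↦ (1 - ‖z‖ ^ 2)⁻¹) (Metric.ball 0 1) := by
    refine ((contDiff_const.sub (contDiff_norm_sq ℂ)).contDiffOn).inv fun z hz ↦ ?_
    exact (unitBall.den_pos (⟨z, hz⟩ : unitBall F)).ne'
  unfold chForm
  exact (contDiffOn_smul_aux hd contDiffOn_const).add (contDiffOn_smul_aux (hd.pow 2)
    ((hr.smulRight hr).add (hI.smulRight hI)).contDiffOn)

theorem unitBall.achart_eq (x y : unitBall F) : achart F x = achart F y := rfl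

theorem unitBall.mem_chart_source (x y : unitBall F) : y ∈ (chartAt F x).source := by
  rw [← coe_achart, unitBall.achart_eq x y, coe_achart]; exact _root_.mem_chart_source F y

theorem unitBall.symmL (x y : unitBall F) :
    (trivializationAt F (TangentSpace 𝓘(ℝ, F)) x).symmL ℝ y = ContinuousLinearMap.id ℝ F := by
  rw [TangentBundle.symmL_trivializationAt_eq_core (unitBall.mem_chart_source x y), unitBall.achart_eq x y]
  ext v
  exact (tangentBundleCore 𝓘(ℝ, F) (unitBall F)).coordChange_self (achart F y) y
    (_root_.mem_chart_source F y) v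

/-- `chForm` as a bilinear form on each tangent space of the ball. -/
def chTensor (x : unitBall F) :
    TangentSpace 𝓘(ℝ, F) x →L[ℝ] TangentSpace 𝓘(ℝ, F) x →L[ℝ] ℝ := chForm (F := F) x

/-- The complex hyperbolic (Bergman) metric on the unit ball, as a smooth Riemannian metric. It is
normalized to have constant holomorphic sectional curvature `-4`; for `F = ℂ` it is
`|dz|² / (1 - |z|²)²`. -/
def ballMetric (F : Type*) [NormedAddCommGroup F] [InnerProductSpace ℂ F] :
    Bundle.ContMDiffRiemannianMetric 𝓘(ℝ, F) ∞ F
      (fun x : unitBall F ↦ TangentSpace 𝓘(ℝ, F) x) where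
  inner x := chTensor x
  symm x v w := chForm_symm (F := F) x v w
  pos x v hv :=
    (pow_pos (norm_pos_iff (E := F).2 hv) 2).trans_le (chForm_self_ge (F := F) x v)
  isVonNBounded x := by
    change Bornology.IsVonNBounded ℝ {v : F | chForm (x : F) v v < 1}
    refine (NormedSpace.isVonNBounded_ball ℝ F 1).subset fun v hv ↦ ?_
    have h := (chForm_self_ge x v).trans_lt hv
    simpa using (sq_lt_one_iff₀ (norm_nonneg v)).1 h
  contMDiff := by
    intro x
    rw [Bundle.contMDiffAt_section]
    have h : ContMDiffAt 𝓘(ℝ, F) 𝓘(ℝ, F →L[ℝ] F →L[ℝ] ℝ) ∞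
        (fun y : unitBall F ↦ chForm (y : F)) x :=
      (contDiffOn_chForm.contDiffAt (Metric.isOpen_ball.mem_nhds x.2)).contMDiffAt.comp x
        (contMDiff_subtype_val x)
    refine h.congr_of_eventuallyEq (Filter.Eventually.of_forall fun y ↦ ?_)
    ext v w
    simp [hom_trivializationAt_apply, ContinuousLinearMap.inCoordinates]
    have hb : y ∈ (trivializationAt (F →L[ℝ] ℝ)
        (fun x : unitBall F ↦ TangentSpace 𝓘(ℝ, F) x →L[ℝ] ℝ) x).baseSet := by
      simpa [hom_trivializationAt_baseSet] using unitBall.mem_chart_source x y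
    rw [Bundle.Trivialization.linearMapAt_apply, if_pos hb, unitBall.symmL]
    simp [hom_trivializationAt_apply, ContinuousLinearMap.inCoordinates]
    rw [unitBall.symmL]
    rfl

section Distance

open scoped Bundle

/-- The tangent spaces of the ball carry the norms given by the complex hyperbolic metric. -/
instance : Bundle.RiemannianBundle (fun x : unitBall F ↦ TangentSpace 𝓘(ℝ, F) x) :=
  ⟨(ballMetric F).toRiemannianMetric⟩

/-- The Riemannian distance of the complex hyperbolic metric: the infimum of the lengths of the
`C¹` paths between two points. -/
def ballDist (x y : unitBall F) : ENNReal := Manifold.riemannianEDist 𝓘(ℝ, F) x y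

/-- The lengths measured by `ballDist` are those of the complex hyperbolic metric. -/
theorem ball_norm_sq (x : unitBall F) (v : TangentSpace 𝓘(ℝ, F) x) :
    ‖v‖ ^ 2 = (ballMetric F).inner x v v := by
  rw [← real_inner_self_eq_norm_sq]
  rfl

end Distance

end ComplexHyperbolic

/-- The complex vector space `ℂⁿ` with its standard Hermitian inner product
`inner ℂ u v = ∑ i, conj (u i) * v i`. -/
abbrev V (n : ℕ) : Type := EuclideanSpace ℂ (Fin n)

/-- Complex hyperbolic space `ℂℍⁿ` as a smooth manifold (ball model). -/
abbrev CH (n : ℕ) : Type := unitBall (V n)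

/-- The complex hyperbolic metric `c_n` on `ℂℍⁿ`, of constant holomorphic sectional
curvature `-4`. -/
def chMetric (n : ℕ) : Bundle.ContMDiffRiemannianMetric 𝓘(ℝ, V n) ∞ (V n)
    (fun x : CH n ↦ TangentSpace 𝓘(ℝ, V n) x) := ballMetric (V n)

/-- The Riemannian distance of the complex hyperbolic metric `c_n` on `ℂℍⁿ`. -/
def chDist {n : ℕ} (x y : CH n) : ENNReal := ballDist x y

theorem chIncl_mem (q : CH 2) :
    (!₂[(q : V 2) 0, (q : V 2) 1, 0, 0, 0] : V 5) ∈ unitBall (V 5) := by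
  have h := unitBall.den_pos q
  rw [EuclideanSpace.norm_sq_eq, Fin.sum_univ_two] at h
  change _ ∈ Metric.ball (0 : V 5) 1
  rw [mem_ball_zero_iff, ← sq_lt_one_iff₀ (norm_nonneg _), EuclideanSpace.norm_sq_eq]
  simp [Fin.sum_univ_five]
  linarith

/-- The standard totally geodesic embedding `ℂℍ² → ℂℍ⁵`, `(q₀, q₁) ↦ (q₀, q₁, 0, 0, 0)`. -/
def chIncl (q : CH 2) : CH 5 := ⟨!₂[(q : V 2) 0, (q : V 2) 1, 0, 0, 0], chIncl_mem q⟩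

theorem range_chIncl :
    Set.range chIncl = {z : CH 5 | (z : V 5) 2 = 0 ∧ (z : V 5) 3 = 0 ∧ (z : V 5) 4 = 0} := by
  ext z
  constructor
  · rintro ⟨q, rfl⟩
    simp [chIncl]
  · rintro ⟨h2, h3, h4⟩
    have hq : (!₂[(z : V 5) 0, (z : V 5) 1] : V 2) ∈ unitBall (V 2) := by
      have h := unitBall.den_pos z
      rw [EuclideanSpace.norm_sq_eq, Fin.sum_univ_five, h2, h3, h4] at h
      change _ ∈ Metric.ball (0 : V 2) 1
      rw [mem_ball_zero_iff, ← sq_lt_one_iff₀ (norm_nonneg _), EuclideanSpace.norm_sq_eq]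
      simp [Fin.sum_univ_two] at h ⊢
      linarith
    refine ⟨⟨_, hq⟩, Subtype.ext ?_⟩
    ext i
    fin_cases i <;> simp [chIncl, h2, h3, h4]

/-- `ℂℍ⁵ \ ℂℍ²`, an open submanifold of `ℂℍ⁵`. -/
def chCompl : TopologicalSpace.Opens (CH 5) :=
  ⟨(Set.range chIncl)ᶜ, by
    rw [isOpen_compl_iff, range_chIncl]
    have hc (i : Fin 5) : IsClosed {z : CH 5 | (z : V 5) i = 0} :=
      isClosed_eq (by fun_prop) continuous_const
    exact (hc 2).inter ((hc 3).inter (hc 4))⟩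

/-- The open half-line `(0, ∞)`. -/
def halfLine : TopologicalSpace.Opens ℝ := ⟨Set.Ioi 0, isOpen_Ioi⟩

/-! ### The sphere `S⁵`, the Hopf fibration and the form `dθ` -/

instance : Fact (Module.finrank ℝ (V 3) = 5 + 1) :=
  ⟨by rw [finrank_real_of_complex]; simp⟩

/-- The unit sphere `S⁵ ⊆ ℂ³`. -/
abbrev S5 : Type := Metric.sphere (0 : V 3) 1

/-- A tangent vector of `S⁵ ⊆ ℂ³`, seen as a vector of `ℂ³`. -/
def S5.toVec {W : S5} (w : TangentSpace (𝓡 5) W) : V 3 :=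
  mfderiv (𝓡 5) 𝓘(ℝ, V 3) (Subtype.val : S5 → V 3) W w

/-- The Fubini-Study metric of constant holomorphic sectional curvature `4` in homogeneous
coordinates: its pull-back under `ℂⁿ \ {0} → ℂPⁿ⁻¹`. -/
def fubiniStudy {n : ℕ} (Z u v : V n) : ℝ :=
  (((‖Z‖ ^ 2 : ℝ) : ℂ) * inner ℂ u v - inner ℂ u Z * inner ℂ Z v).re / ‖Z‖ ^ 4

/-- `fubiniStudy` is well defined on `ℂPⁿ⁻¹`: it does not change when the representative `Z` is
rescaled, nor when vectors along the complex line `ℂ Z` are added to the tangent vectors. -/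
theorem fubiniStudy_smul_add {n : ℕ} (Z u v : V n) (c a b : ℂ) (hc : c ≠ 0) :
    fubiniStudy (c • Z) (c • u + a • Z) (c • v + b • Z) = fubiniStudy Z u v := by
  have hN : inner ℂ Z Z = ((‖Z‖ ^ 2 : ℝ) : ℂ) := by
    rw [inner_self_eq_norm_sq_to_K]; push_cast; rfl
  have hc2 : (starRingEnd ℂ) c * c = ((‖c‖ ^ 2 : ℝ) : ℂ) := by
    rw [Complex.conj_mul']; push_cast; rfl
  have key : ((‖c • Z‖ ^ 2 : ℝ) : ℂ) * inner ℂ (c • u + a • Z) (c • v + b • Z)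
        - inner ℂ (c • u + a • Z) (c • Z) * inner ℂ (c • Z) (c • v + b • Z)
      = ((‖c‖ ^ 4 : ℝ) : ℂ) * (((‖Z‖ ^ 2 : ℝ) : ℂ) * inner ℂ u v - inner ℂ u Z * inner ℂ Z v) := by
    have h1 : ((‖c • Z‖ ^ 2 : ℝ) : ℂ) = (starRingEnd ℂ) c * c * inner ℂ Z Z := by
      rw [hN, hc2, norm_smul, mul_pow]; push_cast; ring
    have h2 : ((‖c‖ ^ 4 : ℝ) : ℂ) = ((starRingEnd ℂ) c * c) ^ 2 := by
      rw [hc2]; push_cast; ring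
    rw [h1, h2, ← hN]
    simp only [inner_add_left, inner_add_right, inner_smul_left, inner_smul_right]
    ring
  have hc' : ‖c‖ ^ 4 ≠ 0 := pow_ne_zero _ (norm_ne_zero_iff.2 hc)
  rw [fubiniStudy, fubiniStudy, key, Complex.re_ofReal_mul, norm_smul, mul_pow,
    mul_div_mul_left _ _ hc']

/-- The pull-back to `S⁵` of the complex projective metric `p_2` on `ℂP²` under the Hopf
fibration `S⁵ → ℂP²`, `W ↦ [W]`. -/
def p2 (W : S5) (w w' : TangentSpace (𝓡 5) W) : ℝ :=
  fubiniStudy (W : V 3) (S5.toVec w) (S5.toVec w')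

/-- The contact form of the Hopf fibration on `S⁵`: it is `1` on the generator `∂/∂θ = i W` of the
circle action and `0` on the orthogonal complement of `∂/∂θ`. -/
def hopfForm (W : S5) (w : TangentSpace (𝓡 5) W) : ℝ := (inner ℂ (W : V 3) (S5.toVec w)).im

/-- The one-form `Im ⟪q, dq⟫ / (1 - ‖q‖²)` on `ℂℍ²`, evaluated at a tangent vector `u`. Its exterior
derivative is twice the Kähler form of `c_2`. -/
def kaehlerPotential (q : CH 2) (u : V 2) : ℝ :=
  (inner ℂ (q : V 2) u).im / (1 - ‖(q : V 2)‖ ^ 2)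

/-- The one-form `dθ` on `ℂℍ² × S⁵`. It is the connection form, with `dθ (∂/∂θ) = 1`, of the circle
bundle `ℂℍ² × S⁵ → ℂℍ² × ℂP²` and restricts to the Hopf contact form on each sphere `{q} × S⁵`. -/
def dTheta (q : CH 2) (W : S5) (u : V 2) (w : TangentSpace (𝓡 5) W) : ℝ :=
  hopfForm W w + kaehlerPotential q u

end

/-! Write `z = (z', z'')` in `ℂ² × ℂ³`. The slice of the ball with `z' = q` is a ball of radius `a =
√(1 - ‖q‖²)`, and `c_5` induces on it the complex hyperbolic metric rescaled to that radius. The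
normal geodesics of `ℂℍ²` at `q` are the radii of this slice, so `Φ(q, W, r) = (q, a tanh r · W)`.
The inverse is explicit: `q = z'`, `W = z''/‖z''‖`, and `sinh² r = S(z)` with `S = ‖z''‖² / (1 -
‖z‖²)`.

The metric formula is a direct computation (`chForm_normal`). Along `Φ` one has `1 - ‖z‖² = a² /
cosh² r`. With `α = Im⟪q, u⟫` and `β = Im⟪W, w⟫`, the imaginary part of `⟪z, v⟫` is `α + a² tanh² r
· β`. Its square, together with the part `β²` of `‖w‖²` missing from `p_2`, gives `sinh² r cosh² r
(β + α/a²)²` plus the `α²` term of `cosh² r · c_2`. In the real parts, the `dr` cross terms cancel.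

For the distance, the metric formula shows that `t ↦ Φ(q, W, t)` has unit speed, so the distance to
`q` is at most `r`. Conversely `arsinh √S` is `1`-Lipschitz and vanishes on `ℂℍ²`, so no point of
`ℂℍ²` is closer than `r`. The Lipschitz bound comes from `dS(v)² ≤ 4 S (1 + S) c_5(v, v)`
(`fderiv_sinhSqDist_sq_le`). -/

noncomputable section

/-! ### Derivatives of maps into open subsets -/

section OpenSubset

variable {F : Type*} [NormedAddCommGroup F] [NormedSpace ℝ F]

/-- The inclusion of an open subset of a normed space has derivative the identity. -/
theorem hasMFDerivAt_opens_val (U : TopologicalSpace.Opens F) (x : U) :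
    HasMFDerivAt 𝓘(ℝ, F) 𝓘(ℝ, F) (Subtype.val : U → F) x (ContinuousLinearMap.id ℝ F) := by
  refine ⟨continuous_subtype_val.continuousAt, ?_⟩
  refine HasFDerivWithinAt.congr_of_eventuallyEq (f := id)
    (hasFDerivWithinAt_id (𝕜 := ℝ) (E := F) _ _) ?_ ?_
  · have h := (TopologicalSpace.Opens.chartAt_subtype_val_symm_eventuallyEq (H := F) U (x := x))
    refine (Filter.EventuallyEq.filter_mono ?_ nhdsWithin_le_nhds)
    filter_upwards [h] with y hy
    exact hy.symm
  · have := (extChartAt 𝓘(ℝ, F) x).left_inv (mem_extChartAt_source x)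
    simp only [writtenInExtChartAt, Function.comp_apply, this]
    rfl

/-- Chain rule with the inclusion, whose derivative is the identity. It reduces derivatives of maps
into the ball to derivatives in the ambient space. -/
theorem mfderiv_opens_eq_mfderiv_val {E H M : Type*} [NormedAddCommGroup E] [NormedSpace ℝ E]
    [TopologicalSpace H] {I : ModelWithCorners ℝ E H} [TopologicalSpace M] [ChartedSpace H M]
    {U : TopologicalSpace.Opens F} {f : M → U} {x : M} (hf : MDifferentiableAt I 𝓘(ℝ, F) f x)
    (v : TangentSpace I x) :
    (mfderiv I 𝓘(ℝ, F) f x v : F) = mfderiv I 𝓘(ℝ, F) (fun y ↦ (f y : F)) x v := by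
  have h := (hasMFDerivAt_opens_val U (f x)).comp x hf.hasMFDerivAt
  have h' := h.mfderiv
  change _ = mfderiv I 𝓘(ℝ, F) (Subtype.val ∘ f) x v
  rw [h']
  rfl

end OpenSubset

/-! ### The orthogonal splitting of `ℂ⁵` -/

/-- The identification `ℂ² × ℂ³ = ℂ⁵`. -/
def joinCoord : (V 2 × V 3) →L[ℝ] V 5 :=
  LinearMap.toContinuousLinearMap
    { toFun := fun p ↦ !₂[p.1 0, p.1 1, p.2 0, p.2 1, p.2 2]
      map_add' := fun p p' ↦ by ext i; fin_cases i <;> simp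
      map_smul' := fun c p ↦ by ext i; fin_cases i <;> simp }

theorem joinCoord_apply (q : V 2) (w : V 3) :
    joinCoord (q, w) = !₂[q 0, q 1, w 0, w 1, w 2] := rfl

/-- The first two coordinates on `ℂ⁵`. -/
def fstCoord : V 5 →L[ℝ] V 2 :=
  LinearMap.toContinuousLinearMap
    { toFun := fun z ↦ !₂[z 0, z 1]
      map_add' := fun p p' ↦ by ext i; fin_cases i <;> simp
      map_smul' := fun c p ↦ by ext i; fin_cases i <;> simp }

/-- The last three coordinates on `ℂ⁵`. -/
def sndCoord : V 5 →L[ℝ] V 3 :=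
  LinearMap.toContinuousLinearMap
    { toFun := fun z ↦ !₂[z 2, z 3, z 4]
      map_add' := fun p p' ↦ by ext i; fin_cases i <;> simp
      map_smul' := fun c p ↦ by ext i; fin_cases i <;> simp }

theorem fstCoord_apply (z : V 5) : fstCoord z = !₂[z 0, z 1] := rfl

theorem sndCoord_apply (z : V 5) : sndCoord z = !₂[z 2, z 3, z 4] := rfl

@[simp] theorem fstCoord_joinCoord (q : V 2) (w : V 3) : fstCoord (joinCoord (q, w)) = q := by
  ext i; fin_cases i <;> simp [fstCoord_apply, joinCoord_apply]

@[simp] theorem sndCoord_joinCoord (q : V 2) (w : V 3) : sndCoord (joinCoord (q, w)) = w := by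
  ext i; fin_cases i <;> simp [sndCoord_apply, joinCoord_apply]

@[simp] theorem joinCoord_coords (z : V 5) : joinCoord (fstCoord z, sndCoord z) = z := by
  ext i; fin_cases i <;> simp [fstCoord_apply, sndCoord_apply, joinCoord_apply]

theorem inner_joinCoord (q q' : V 2) (w w' : V 3) :
    inner ℂ (joinCoord (q, w)) (joinCoord (q', w')) = inner ℂ q q' + inner ℂ w w' := by
  simp [joinCoord_apply, PiLp.inner_apply, Fin.sum_univ_succ]
  ring

theorem norm_sq_joinCoord (q : V 2) (w : V 3) : ‖joinCoord (q, w)‖ ^ 2 = ‖q‖ ^ 2 + ‖w‖ ^ 2 := by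
  simp [joinCoord_apply, EuclideanSpace.norm_sq_eq, Fin.sum_univ_succ]
  ring

theorem norm_sq_eq_coords (z : V 5) : ‖z‖ ^ 2 = ‖fstCoord z‖ ^ 2 + ‖sndCoord z‖ ^ 2 := by
  rw [← norm_sq_joinCoord, joinCoord_coords]

theorem inner_eq_coords (z z' : V 5) :
    inner ℂ z z' = inner ℂ (fstCoord z) (fstCoord z') + inner ℂ (sndCoord z) (sndCoord z') := by
  rw [← inner_joinCoord, joinCoord_coords, joinCoord_coords]

theorem chIncl_eq_joinCoord (q : CH 2) : (chIncl q : V 5) = joinCoord (q, 0) := by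
  simp [chIncl, joinCoord_apply]

theorem mem_range_chIncl_iff (z : CH 5) : z ∈ Set.range chIncl ↔ sndCoord z = 0 := by
  rw [range_chIncl]
  constructor
  · rintro ⟨h2, h3, h4⟩
    ext i; fin_cases i <;> simp [sndCoord_apply, h2, h3, h4]
  · intro h
    exact ⟨by simpa [sndCoord_apply] using congrArg (fun w : V 3 ↦ w 0) h,
      by simpa [sndCoord_apply] using congrArg (fun w : V 3 ↦ w 1) h,
      by simpa [sndCoord_apply] using congrArg (fun w : V 3 ↦ w 2) h⟩

/-! ### The normal exponential map and the pulled-back metric -/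

/-- The point at distance `r` from `(q, 0)` on the normal geodesic with direction `(0, W)`. -/
def normalExp (p : (V 2 × V 3) × ℝ) : V 5 :=
  joinCoord (p.1.1, (Real.sqrt (1 - ‖p.1.1‖ ^ 2) * (Real.sinh p.2 / Real.cosh p.2)) • p.1.2)

theorem hasFDerivAt_normalExp {q : V 2} (hq : 0 < 1 - ‖q‖ ^ 2) (W : V 3) (r : ℝ) :
    ∃ D : ((V 2 × V 3) × ℝ) →L[ℝ] V 5, HasFDerivAt normalExp D ((q, W), r) ∧
      ∀ (u : V 2) (w : V 3) (ρ : ℝ), D ((u, w), ρ) = joinCoord (u,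
        (Real.sqrt (1 - ‖q‖ ^ 2) * (ρ / Real.cosh r ^ 2)
          - (inner ℂ q u).re / Real.sqrt (1 - ‖q‖ ^ 2) * (Real.sinh r / Real.cosh r)) • W
        + (Real.sqrt (1 - ‖q‖ ^ 2) * (Real.sinh r / Real.cosh r)) • w) := by
  have hfst : HasFDerivAt (fun p : (V 2 × V 3) × ℝ ↦ p.1.1)
      ((ContinuousLinearMap.fst ℝ (V 2) (V 3)).comp (ContinuousLinearMap.fst ℝ _ ℝ)) ((q, W), r) :=
    ContinuousLinearMap.hasFDerivAt
      ((ContinuousLinearMap.fst ℝ (V 2) (V 3)).comp (ContinuousLinearMap.fst ℝ _ ℝ))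
  have hsnd : HasFDerivAt (fun p : (V 2 × V 3) × ℝ ↦ p.1.2)
      ((ContinuousLinearMap.snd ℝ (V 2) (V 3)).comp (ContinuousLinearMap.fst ℝ _ ℝ)) ((q, W), r) :=
    ContinuousLinearMap.hasFDerivAt
      ((ContinuousLinearMap.snd ℝ (V 2) (V 3)).comp (ContinuousLinearMap.fst ℝ _ ℝ))
  have hr : HasFDerivAt (fun p : (V 2 × V 3) × ℝ ↦ p.2)
      (ContinuousLinearMap.snd ℝ (V 2 × V 3) ℝ) ((q, W), r) :=
    ContinuousLinearMap.hasFDerivAt (ContinuousLinearMap.snd ℝ (V 2 × V 3) ℝ)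
  have hn : HasFDerivAt (fun x : V 2 ↦ 1 - ‖x‖ ^ 2) (-(2 • realInner (V 2) q)) q := by
    have := (@hasStrictFDerivAt_norm_sq (V 2) _ InnerProductSpace.complexToReal q).hasFDerivAt
    exact this.const_sub 1
  have hsq := (HasFDerivAt.comp (f := fun p : (V 2 × V 3) × ℝ ↦ p.1.1) ((q, W), r) hn hfst).sqrt
    (show ((fun x : V 2 ↦ 1 - ‖x‖ ^ 2) ∘ fun p : (V 2 × V 3) × ℝ ↦ p.1.1) ((q, W), r) ≠ 0 from hq.ne')
  have hc := (Real.cosh_pos r).ne'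
  have ht : HasDerivAt (fun x ↦ Real.sinh x / Real.cosh x) (1 / Real.cosh r ^ 2) r := by
    have := (Real.hasDerivAt_sinh r).div (Real.hasDerivAt_cosh r) hc
    rwa [← sq, ← sq, Real.cosh_sq_sub_sinh_sq] at this
  have htr := ht.comp_hasFDerivAt ((q, W), r) hr
  have hall := (joinCoord.hasFDerivAt).comp ((q, W), r)
    (hfst.prodMk ((hsq.mul htr).smul hsnd))
  refine ⟨_, hall, fun u w ρ ↦ ?_⟩
  simp [realInner_apply]
  congr 2
  rw [add_comm]
  congr 2
  have := (Real.sqrt_pos.2 hq).ne'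
  field_simp
  ring

/-- The pull-back of `chForm` under `normalExp`, in terms of inner products. -/
theorem chForm_normal {q : V 2} (hq : 0 < 1 - ‖q‖ ^ 2) {W : V 3} (hW : ‖W‖ = 1) (r : ℝ)
    (u u' : V 2) {w w' : V 3} (hw : (inner ℂ W w).re = 0) (hw' : (inner ℂ W w').re = 0)
    (ρ ρ' : ℝ) {a t : ℝ} (ha : a = Real.sqrt (1 - ‖q‖ ^ 2)) (ht : t = Real.sinh r / Real.cosh r) :
    chForm (joinCoord (q, (a * t) • W))
      (joinCoord (u, (a * (ρ / Real.cosh r ^ 2) - (inner ℂ q u).re / a * t) • W + (a * t) • w))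
      (joinCoord (u', (a * (ρ' / Real.cosh r ^ 2) - (inner ℂ q u').re / a * t) • W + (a * t) • w'))
      = Real.cosh r ^ 2 * chForm q u u' + Real.sinh r ^ 2 * fubiniStudy W w w'
        + 1 / 4 * Real.sinh (2 * r) ^ 2 *
          (((inner ℂ W w).im + (inner ℂ q u).im / (1 - ‖q‖ ^ 2))
            * ((inner ℂ W w').im + (inner ℂ q u').im / (1 - ‖q‖ ^ 2)))
        + ρ * ρ' := by
  have ha0 : 0 < a := ha ▸ Real.sqrt_pos.2 hq
  have ha2 : 1 - ‖q‖ ^ 2 = a ^ 2 := by rw [ha, Real.sq_sqrt hq.le]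
  have hc := Real.cosh_pos r
  have hcs := Real.cosh_sq r
  have hWW : inner ℂ W W = 1 := by rw [inner_self_eq_norm_sq_to_K, hW]; norm_num
  have hwW : (inner ℂ w W).re = 0 := by rw [← inner_conj_symm, Complex.conj_re, hw]
  have hwWi : (inner ℂ w W).im = -(inner ℂ W w).im := by
    rw [← inner_conj_symm, Complex.conj_im]
  have hN : 1 - ‖joinCoord (q, (a * t) • W)‖ ^ 2 = a ^ 2 / Real.cosh r ^ 2 := by
    rw [norm_sq_joinCoord, norm_smul, mul_pow, hW, Real.norm_eq_abs, sq_abs, ← sub_sub, ha2, ht]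
    field_simp
    rw [hcs]; ring
  rw [chForm_eq, hN, chForm_eq, fubiniStudy, hW, Real.sinh_two_mul, ha2]
  -- The real coefficients stay opaque while the inner products are expanded by sesquilinearity.
  generalize hσ : a * (ρ / Real.cosh r ^ 2) - (inner ℂ q u).re / a * t = σ
  generalize hσ' : a * (ρ' / Real.cosh r ^ 2) - (inner ℂ q u').re / a * t = σ'
  generalize hτ : a * t = τ
  simp only [inner_joinCoord, ← Complex.coe_smul, inner_add_left, inner_add_right,
    inner_smul_left, inner_smul_right, hWW, Complex.conj_ofReal]
  simp [hw, hw', hwW, hwWi]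
  rw [← hσ, ← hσ', ← hτ]
  generalize (inner ℂ q u).re = A
  generalize (inner ℂ q u').re = A'
  generalize (inner ℂ q u).im = α
  generalize (inner ℂ q u').im = α'
  generalize (inner ℂ W w).im = β
  generalize (inner ℂ W w').im = β'
  generalize (inner ℂ u u').re = X
  generalize (inner ℂ w w').re = Y
  rw [ht]
  clear ht hN hσ hσ' hτ
  generalize Real.cosh r = c at *
  generalize Real.sinh r = s at *
  field_simp
  -- What remains is a polynomial identity modulo `c² - s² = 1`; powers of `s` above the first are
  -- eliminated.
  have hs : s ^ 2 = c ^ 2 - 1 := by linarith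
  have h3 : s ^ 3 = s * (c ^ 2 - 1) := by rw [← hs]; ring
  have h4 : s ^ 4 = (c ^ 2 - 1) ^ 2 := by rw [← hs]; ring
  ring_nf
  simp only [hs, h3, h4]
  ring

/-! ### Lower bound for the distance to `ℂℍ²` -/

open scoped Bundle

section

variable {F : Type*} [NormedAddCommGroup F] [InnerProductSpace ℂ F]

theorem enorm_ball_tangent (x : unitBall F) (v : TangentSpace 𝓘(ℝ, F) x) :
    ‖v‖ₑ = ENNReal.ofReal (Real.sqrt (chForm (x : F) v v)) := by
  rw [← ofReal_norm, ← Real.sqrt_sq (norm_nonneg v), ball_norm_sq]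
  rfl

/-- A function whose differential has norm at most one for the complex hyperbolic metric is
`1`-Lipschitz. -/
theorem ofReal_sub_le_ballDist {f : F → ℝ} (hf : ContDiffOn ℝ 1 f (Metric.ball 0 1))
    (hle : ∀ x ∈ Metric.ball (0 : F) 1, ∀ v, (fderiv ℝ f x v) ^ 2 ≤ chForm x v v)
    (x y : unitBall F) : ENNReal.ofReal (f x - f y) ≤ ballDist x y := by
  rw [ballDist]
  refine le_of_forall_gt fun R hR ↦ ?_
  -- For a `C¹` path `γ` of length less than `R`, `|f (γ 1) - f (γ 0)| ≤ ∫ |(f ∘ γ)'|`, and the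
  -- integrand is at most the speed of `γ`.
  obtain ⟨γ, h0, h1, hγ, hlen, -, -⟩ :=
    Manifold.exists_lt_locally_constant_of_riemannianEDist_lt hR zero_lt_one
  refine lt_of_le_of_lt ?_ hlen
  have hc : ContDiff ℝ 1 (fun t ↦ (γ t : F)) := by
    rw [← contMDiff_iff_contDiff]
    exact contMDiff_subtype_val.comp hγ
  have hfc : ContDiff ℝ 1 (fun t ↦ f (γ t)) :=
    contDiff_iff_contDiffAt.2 fun t ↦
      (hf.contDiffAt (Metric.isOpen_ball.mem_nhds (γ t).2)).comp t hc.contDiffAt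
  have hint := enorm_sub_le_lintegral_deriv_of_contDiffOn_Icc (hfc.contDiffOn) zero_le_one
  calc ENNReal.ofReal (f x - f y) ≤ ‖f (γ 1) - f (γ 0)‖ₑ := by
        rw [h0, h1, ← ofReal_norm]
        refine ENNReal.ofReal_le_ofReal ?_
        rw [Real.norm_eq_abs, abs_sub_comm]
        exact le_abs_self _
    _ ≤ _ := hint
    _ ≤ Manifold.pathELength 𝓘(ℝ, F) γ 0 1 := by
        rw [Manifold.pathELength_eq_lintegral_mfderiv_Icc]
        refine MeasureTheory.lintegral_mono fun t ↦ ?_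
        rw [enorm_ball_tangent, ← ofReal_norm]
        refine ENNReal.ofReal_le_ofReal ?_
        rw [mfderiv_opens_eq_mfderiv_val (hγ.mdifferentiableAt one_ne_zero), mfderiv_eq_fderiv]
        rw [Real.norm_eq_abs, ← Real.sqrt_sq_eq_abs]
        refine Real.sqrt_le_sqrt ?_
        have hd : HasFDerivAt f (fderiv ℝ f (γ t)) (γ t : F) :=
          ((hf.contDiffAt (Metric.isOpen_ball.mem_nhds (γ t).2)).differentiableAt
            one_ne_zero).hasFDerivAt
        have : HasDerivAt (fun t ↦ f (γ t)) _ t :=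
          hd.comp_hasDerivAt t ((hc.differentiable one_ne_zero t).hasFDerivAt.hasDerivAt)
        rw [HasDerivAt.deriv this]
        exact hle _ (γ t).2 _

end

/-- `sinh²` of the distance to `ℂℍ²`. -/
def sinhSqDist (z : V 5) : ℝ := ‖sndCoord z‖ ^ 2 / (1 - ‖z‖ ^ 2)

theorem sinhSqDist_nonneg {z : V 5} (hz : z ∈ Metric.ball (0 : V 5) 1) : 0 ≤ sinhSqDist z :=
  div_nonneg (sq_nonneg _) (unitBall.den_pos ⟨z, hz⟩).le

theorem contDiffOn_sinhSqDist : ContDiffOn ℝ ∞ sinhSqDist (Metric.ball 0 1) := by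
  refine ContDiffOn.div ?_ ?_ fun z hz ↦ (unitBall.den_pos ⟨z, hz⟩).ne'
  · exact ((contDiff_norm_sq ℂ).comp sndCoord.contDiff).contDiffOn
  · exact (contDiff_const.sub (contDiff_norm_sq ℂ)).contDiffOn

/-- With `S = sinh² r` and `|dr| ≤ 1`, `dS = 2 sinh r cosh r dr` predicts exactly this factor; the
form without square roots also makes sense on `ℂℍ²`. -/
theorem fderiv_sinhSqDist_sq_le {z : V 5} (hz : z ∈ Metric.ball (0 : V 5) 1) (v : V 5) :
    (fderiv ℝ sinhSqDist z v) ^ 2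
      ≤ 4 * (sinhSqDist z * (1 + sinhSqDist z)) * chForm z v v := by
  have hN := unitBall.den_pos ⟨z, hz⟩
  have hsq {n : ℕ} (x : V n) : HasFDerivAt (fun x : V n ↦ ‖x‖ ^ 2) (2 • realInner (V n) x) x :=
    (@hasStrictFDerivAt_norm_sq (V n) _ InnerProductSpace.complexToReal x).hasFDerivAt
  have hP := (hsq (sndCoord z)).comp z sndCoord.hasFDerivAt
  have hden := (hsq z).const_sub 1
  have hS := hP.mul ((hasDerivAt_inv hN.ne').comp_hasFDerivAt z hden)
  have hS' : HasFDerivAt sinhSqDist _ z := hS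
  rw [hS'.fderiv, sinhSqDist, chForm_eq]
  have hvv : (inner ℂ v v).re = ‖fstCoord v‖ ^ 2 + ‖sndCoord v‖ ^ 2 := by
    rw [← norm_sq_eq_coords]; simpa using inner_self_eq_norm_sq (𝕜 := ℂ) v
  rw [hvv]
  simp [realInner_apply]
  have hb : (inner ℂ (sndCoord z) (sndCoord v)).re ^ 2 ≤ ‖sndCoord z‖ ^ 2 * ‖sndCoord v‖ ^ 2 := by
    rw [← mul_pow, sq_le_sq, abs_of_nonneg (by positivity : 0 ≤ ‖sndCoord z‖ * ‖sndCoord v‖)]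
    exact (Complex.abs_re_le_norm _).trans (norm_inner_le_norm _ _)
  have hab : (inner ℂ z v).re = (inner ℂ (fstCoord z) (fstCoord v)).re
      + (inner ℂ (sndCoord z) (sndCoord v)).re := by
    rw [inner_eq_coords]; rfl
  rw [hab]
  generalize (inner ℂ (fstCoord z) (fstCoord v)).re = a at *
  generalize (inner ℂ (sndCoord z) (sndCoord v)).re = b at *
  generalize (inner ℂ z v).im = i at *
  have hP0 : 0 ≤ ‖sndCoord z‖ ^ 2 := sq_nonneg _
  have hU0 : 0 ≤ ‖fstCoord v‖ ^ 2 := sq_nonneg _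
  change 0 < 1 - ‖z‖ ^ 2 at hN
  generalize ‖fstCoord v‖ ^ 2 = U at *
  generalize ‖sndCoord v‖ ^ 2 = Y at *
  generalize ‖sndCoord z‖ ^ 2 = P at *
  generalize 1 - ‖z‖ ^ 2 = N at *
  have hNP : 0 ≤ (N + P) * N := by positivity
  -- Here `dS(v) = 2 (P (a + b) + N b) / N²` and `S (1 + S) = P (N + P) / N²`. The difference of the
  -- two sides is exactly the sum of `h1` to `h4`; Cauchy–Schwarz enters only through `b² ≤ P Y`.
  have key : (P * (a + b) + N * b) ^ 2
      ≤ P * (N + P) * (N * (U + Y) + ((a + b) * (a + b) + i * i)) := by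
    have h1 : 0 ≤ P * ((N + P) * N) * U := by positivity
    have h2 : 0 ≤ (N + P) * N * (P * Y - b ^ 2) := mul_nonneg hNP (sub_nonneg.2 hb)
    have h3 : 0 ≤ P * N * a ^ 2 := by positivity
    have h4 : 0 ≤ P * (N + P) * (i * i) := mul_nonneg (by positivity) (mul_self_nonneg i)
    linarith
  calc _ = 4 / N ^ 4 * (P * (a + b) + N * b) ^ 2 := by field_simp; ring
    _ ≤ 4 / N ^ 4 * (P * (N + P) * (N * (U + Y) + ((a + b) * (a + b) + i * i))) :=
        mul_le_mul_of_nonneg_left key (by positivity)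
    _ = _ := by field_simp

/-- A smoothing of the distance to `ℂℍ²`. -/
def smoothDist (ε : ℝ) (z : V 5) : ℝ := Real.arsinh (Real.sqrt (sinhSqDist z + ε))

theorem contDiffOn_smoothDist {ε : ℝ} (hε : 0 < ε) :
    ContDiffOn ℝ 1 (smoothDist ε) (Metric.ball 0 1) := by
  refine Real.contDiff_arsinh.comp_contDiffOn (ContDiffOn.sqrt ?_ fun z hz ↦ ?_)
  · exact (contDiffOn_sinhSqDist.of_le (by norm_cast)).add contDiffOn_const
  · have := sinhSqDist_nonneg hz
    positivity

theorem fderiv_smoothDist_sq_le {ε : ℝ} (hε : 0 < ε) {z : V 5} (hz : z ∈ Metric.ball (0 : V 5) 1)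
    (v : V 5) : (fderiv ℝ (smoothDist ε) z v) ^ 2 ≤ chForm z v v := by
  have hS := sinhSqDist_nonneg hz
  have hpos : 0 < sinhSqDist z + ε := by positivity
  have hd : HasFDerivAt sinhSqDist (fderiv ℝ sinhSqDist z) z :=
    ((contDiffOn_sinhSqDist.contDiffAt (Metric.isOpen_ball.mem_nhds hz)).differentiableAt
      (by simp)).hasFDerivAt
  have hf : HasFDerivAt (smoothDist ε) _ z := ((hd.add_const ε).sqrt hpos.ne').arsinh
  have hg : 0 ≤ chForm z v v := (sq_nonneg _).trans (chForm_self_ge ⟨z, hz⟩ v)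
  have hle := fderiv_sinhSqDist_sq_le hz v
  rw [hf.fderiv]
  simp only [smul_apply, smul_eq_mul, mul_pow, inv_pow]
  rw [Real.sq_sqrt hpos.le, Real.sq_sqrt (by positivity), one_div, inv_pow, mul_pow,
    Real.sq_sqrt hpos.le, ← mul_assoc, ← mul_inv, inv_mul_le_iff₀ (by positivity)]
  refine hle.trans (mul_le_mul_of_nonneg_right ?_ hg)
  nlinarith

/-- The function `arsinh √S` is not differentiable on `ℂℍ²`, where `S = 0`. The Lipschitz bound is
applied to `arsinh √(S + ε)`, and `ε` tends to `0` from above. -/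
theorem le_chDist_chIncl (z : CH 5) (y : CH 2) :
    ENNReal.ofReal (Real.arsinh (Real.sqrt (sinhSqDist z))) ≤ chDist z (chIncl y) := by
  have hy : sinhSqDist (chIncl y) = 0 := by
    rw [sinhSqDist, chIncl_eq_joinCoord, sndCoord_joinCoord]; simp
  have key (ε : ℝ) (hε : 0 < ε) : ENNReal.ofReal (Real.arsinh (Real.sqrt (sinhSqDist z + ε))
      - Real.arsinh (Real.sqrt ε)) ≤ chDist z (chIncl y) := by
    have := ofReal_sub_le_ballDist (contDiffOn_smoothDist hε)
      (fun x hx v ↦ fderiv_smoothDist_sq_le hε hx v) z (chIncl y)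
    rwa [smoothDist, smoothDist, hy, zero_add] at this
  have hlim : Filter.Tendsto (fun ε : ℝ ↦ ENNReal.ofReal (Real.arsinh (Real.sqrt (sinhSqDist z + ε))
      - Real.arsinh (Real.sqrt ε))) (nhdsWithin 0 (Set.Ioi 0))
      (nhds (ENNReal.ofReal (Real.arsinh (Real.sqrt (sinhSqDist z))))) := by
    have hcont : Continuous (fun ε : ℝ ↦ ENNReal.ofReal
        (Real.arsinh (Real.sqrt (sinhSqDist z + ε)) - Real.arsinh (Real.sqrt ε))) := by
      refine ENNReal.continuous_ofReal.comp ?_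
      exact (Real.continuous_arsinh.comp (by fun_prop)).sub (Real.continuous_arsinh.comp (by fun_prop))
    have := hcont.tendsto 0
    simp only [add_zero, Real.sqrt_zero, Real.arsinh_zero, sub_zero] at this
    exact this.mono_left nhdsWithin_le_nhds
  exact le_of_tendsto hlim (Filter.eventually_of_mem self_mem_nhdsWithin fun ε hε ↦ key ε hε)

/-! ### Upper bound for the distance: the normal geodesic -/

theorem one_sub_norm_sq_normalExp {q : V 2} (hq : 0 < 1 - ‖q‖ ^ 2) {W : V 3} (hW : ‖W‖ = 1)
    (r : ℝ) : 1 - ‖normalExp ((q, W), r)‖ ^ 2 = (1 - ‖q‖ ^ 2) / Real.cosh r ^ 2 := by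
  have hc := (Real.cosh_pos r).ne'
  rw [normalExp, norm_sq_joinCoord, norm_smul, mul_pow, hW, Real.norm_eq_abs, sq_abs, mul_pow,
    Real.sq_sqrt hq.le]
  field_simp
  rw [Real.cosh_sq r]
  ring

theorem mem_ball_of_den_pos {F : Type*} [NormedAddCommGroup F] {z : F} (h : 0 < 1 - ‖z‖ ^ 2) :
    z ∈ Metric.ball (0 : F) 1 := by
  rw [mem_ball_zero_iff, ← sq_lt_one_iff₀ (norm_nonneg _)]
  linarith

theorem normalExp_mem {q : V 2} (hq : 0 < 1 - ‖q‖ ^ 2) {W : V 3} (hW : ‖W‖ = 1) (r : ℝ) :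
    normalExp ((q, W), r) ∈ unitBall (V 5) := by
  refine mem_ball_of_den_pos ?_
  rw [one_sub_norm_sq_normalExp hq hW]
  have := Real.cosh_pos r
  positivity

theorem sinhSqDist_normalExp {q : V 2} (hq : 0 < 1 - ‖q‖ ^ 2) {W : V 3} (hW : ‖W‖ = 1) (r : ℝ) :
    sinhSqDist (normalExp ((q, W), r)) = Real.sinh r ^ 2 := by
  have hc := (Real.cosh_pos r).ne'
  rw [sinhSqDist, one_sub_norm_sq_normalExp hq hW, normalExp, sndCoord_joinCoord, norm_smul, hW,
    Real.norm_eq_abs, mul_one, sq_abs, mul_pow, Real.sq_sqrt hq.le]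
  field_simp

theorem contDiffAt_normalExp {q : V 2} (hq : 0 < 1 - ‖q‖ ^ 2) (W : V 3) (r : ℝ) :
    ContDiffAt ℝ ∞ normalExp ((q, W), r) := by
  have h1 : ContDiffAt ℝ ∞ (fun p : (V 2 × V 3) × ℝ ↦ Real.sqrt (1 - ‖p.1.1‖ ^ 2)) ((q, W), r) :=
    ContDiffAt.sqrt (contDiffAt_const.sub ((contDiff_norm_sq ℂ).contDiffAt.comp _
      (contDiffAt_fst.comp _ contDiffAt_fst))) hq.ne'
  have h2 : ContDiffAt ℝ ∞ (fun p : (V 2 × V 3) × ℝ ↦ Real.sinh p.2 / Real.cosh p.2)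
      ((q, W), r) :=
    ContDiffAt.div (Real.contDiff_sinh.contDiffAt.comp _ contDiffAt_snd)
      (Real.contDiff_cosh.contDiffAt.comp _ contDiffAt_snd) (Real.cosh_pos _).ne'
  exact joinCoord.contDiff.contDiffAt.comp _ ((contDiffAt_fst.comp _ contDiffAt_fst).prodMk
    ((h1.mul h2).smul (contDiffAt_snd.comp _ contDiffAt_fst)))

theorem chDist_normalExp_le (q : CH 2) {W : V 3} (hW : ‖W‖ = 1) {r : ℝ} (hr : 0 ≤ r) (z : CH 5)
    (hz : (z : V 5) = normalExp ((q, W), r)) :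
    chDist z (chIncl q) ≤ ENNReal.ofReal r := by
  have hq := unitBall.den_pos q
  let γ : ℝ → CH 5 := fun t ↦ ⟨normalExp ((q, W), t), normalExp_mem hq hW t⟩
  have hγ : ContMDiff 𝓘(ℝ, ℝ) 𝓘(ℝ, V 5) ∞ γ := by
    rw [← ContMDiff.subtypeVal_comp_iff]
    refine ContDiff.contMDiff (contDiff_iff_contDiffAt.2 fun t ↦ ?_)
    exact (contDiffAt_normalExp hq W t).comp t (contDiffAt_const.prodMk contDiffAt_id)
  have hγ1 : ContMDiff 𝓘(ℝ, ℝ) 𝓘(ℝ, V 5) 1 γ := hγ.of_le (by norm_cast)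
  have hγ0 : γ 0 = chIncl q := by
    refine Subtype.ext ?_
    rw [chIncl_eq_joinCoord]
    simp [γ, normalExp]
  have hγr : γ r = z := Subtype.ext hz.symm
  rw [chDist, ballDist, Manifold.riemannianEDist_comm]
  refine (Manifold.riemannianEDist_le_pathELength hγ1.contMDiffOn hγ0 hγr hr).trans ?_
  rw [Manifold.pathELength_eq_lintegral_mfderiv_Icc]
  calc _ ≤ ∫⁻ _ in Set.Icc (0 : ℝ) r, 1 := by
        refine MeasureTheory.lintegral_mono fun t ↦ ?_
        rw [enorm_ball_tangent,
          mfderiv_opens_eq_mfderiv_val (hγ1.mdifferentiableAt one_ne_zero), mfderiv_eq_fderiv]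
        obtain ⟨D, hD, hDv⟩ := hasFDerivAt_normalExp hq W t
        have hline : HasFDerivAt (fun t : ℝ ↦ ((((q : V 2), W), t) : (V 2 × V 3) × ℝ))
          ((0 : ℝ →L[ℝ] V 2 × V 3).prod (ContinuousLinearMap.id ℝ ℝ)) t :=
          (hasFDerivAt_const _ _).prodMk (hasFDerivAt_id t)
        have hcomp : HasFDerivAt (fun t ↦ (γ t : V 5)) _ t := hD.comp t hline
        rw [hcomp.fderiv]
        have hv := hDv 0 0 1
        -- Along the curve only `r` varies, so `dr²` alone survives and the speed is `1`.
        have h := chForm_normal hq hW t 0 0 (w := 0) (w' := 0) (by simp) (by simp) 1 1 rfl rfl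
        have h1 : chForm (γ t : V 5) (D ((0, 0), 1)) (D ((0, 0), 1)) = 1 := by
          rw [hv]
          refine h.trans ?_
          simp [fubiniStudy]
        refine (congrArg (fun x ↦ ENNReal.ofReal (Real.sqrt x)) h1).le.trans ?_
        simp
    _ = ENNReal.ofReal r := by simp

/-! ### The inverse map and the diffeomorphism -/

theorem mem_chCompl_iff (z : CH 5) : z ∈ chCompl ↔ sndCoord z ≠ 0 :=
  (mem_range_chIncl_iff z).not

theorem norm_sndCoord_normalExp (q : V 2) {W : V 3} (hW : ‖W‖ = 1) {r : ℝ} (hr : 0 ≤ r) :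
    ‖sndCoord (normalExp ((q, W), r))‖
      = Real.sqrt (1 - ‖q‖ ^ 2) * (Real.sinh r / Real.cosh r) := by
  have hs := Real.sinh_nonneg_iff.2 hr
  have hc := Real.cosh_pos r
  rw [normalExp, sndCoord_joinCoord, norm_smul, hW, mul_one, Real.norm_eq_abs,
    abs_of_nonneg (by positivity)]

/-- The distance from a point of `ℂℍ⁵` to `ℂℍ²`. -/
def distToCH2 (z : V 5) : ℝ := Real.arsinh (Real.sqrt (sinhSqDist z))

theorem distToCH2_normalExp {q : V 2} (hq : 0 < 1 - ‖q‖ ^ 2) {W : V 3} (hW : ‖W‖ = 1) {r : ℝ}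
    (hr : 0 ≤ r) : distToCH2 (normalExp ((q, W), r)) = r := by
  rw [distToCH2, sinhSqDist_normalExp hq hW, Real.sqrt_sq (Real.sinh_nonneg_iff.2 hr),
    Real.arsinh_sinh]

theorem sinhSqDist_pos {z : V 5} (hz : 0 < 1 - ‖z‖ ^ 2) (h : sndCoord z ≠ 0) :
    0 < sinhSqDist z :=
  div_pos (pow_pos (norm_pos_iff.2 h) 2) hz

theorem den_pos_fstCoord {z : V 5} (hz : 0 < 1 - ‖z‖ ^ 2) : 0 < 1 - ‖fstCoord z‖ ^ 2 := by
  rw [norm_sq_eq_coords] at hz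
  linarith [sq_nonneg ‖sndCoord z‖]

theorem normalExp_coords {z : V 5} (hz : 0 < 1 - ‖z‖ ^ 2) (h : sndCoord z ≠ 0) :
    normalExp ((fstCoord z, ‖sndCoord z‖⁻¹ • sndCoord z), distToCH2 z) = z := by
  have hS := sinhSqDist_pos hz h
  have hq := den_pos_fstCoord hz
  have hw := norm_pos_iff.2 h
  have key : Real.sqrt (1 - ‖fstCoord z‖ ^ 2)
      * (Real.sinh (distToCH2 z) / Real.cosh (distToCH2 z)) = ‖sndCoord z‖ := by
    rw [distToCH2, Real.sinh_arsinh, Real.cosh_arsinh, Real.sq_sqrt hS.le,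
      ← sq_eq_sq₀ (by positivity) hw.le, mul_pow, div_pow, Real.sq_sqrt hq.le,
      Real.sq_sqrt hS.le, Real.sq_sqrt (by positivity)]
    -- Hence `tanh² r = S / (1 + S) = ‖z''‖² / (1 - ‖z'‖²)`.
    have h1 : 1 + sinhSqDist z = (1 - ‖fstCoord z‖ ^ 2) / (1 - ‖z‖ ^ 2) := by
      rw [sinhSqDist, one_add_div hz.ne']
      congr 1
      rw [norm_sq_eq_coords z]
      ring
    rw [h1, sinhSqDist]
    field_simp
  rw [normalExp]
  simp only
  rw [key, smul_smul, mul_inv_cancel₀ hw.ne', one_smul, joinCoord_coords]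

theorem norm_S5 (W : S5) : ‖(W : V 3)‖ = 1 := mem_sphere_zero_iff_norm.1 W.2

theorem normalExp_mem_chCompl (q : CH 2) (W : S5) (r : halfLine) :
    (⟨normalExp ((q, W), r), normalExp_mem (unitBall.den_pos q) (norm_S5 W) r⟩ : CH 5)
      ∈ chCompl := by
  rw [mem_chCompl_iff, ← norm_pos_iff]
  have hr : (0 : ℝ) < r := r.2
  have hs := Real.sinh_pos_iff.2 hr
  have hc := Real.cosh_pos (r : ℝ)
  have hq := unitBall.den_pos q
  have := Real.sqrt_pos.2 hq
  refine (norm_sndCoord_normalExp q (norm_S5 W) hr.le).symm ▸ ?_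
  positivity

/-- The normal exponential map of `ℂℍ²`, away from the zero section. -/
def normalExpCH (p : (CH 2 × S5) × halfLine) : chCompl :=
  ⟨⟨normalExp ((p.1.1, p.1.2), p.2), normalExp_mem (unitBall.den_pos p.1.1) (norm_S5 p.1.2) p.2⟩,
    normalExp_mem_chCompl p.1.1 p.1.2 p.2⟩

theorem sndCoord_ne_zero (z : chCompl) : sndCoord (z : CH 5) ≠ 0 :=
  (mem_chCompl_iff z).1 z.2

/-- The inverse of `normalExpCH`. -/
def normalCoords (z : chCompl) : (CH 2 × S5) × halfLine :=
  ((⟨fstCoord (z : CH 5), mem_ball_of_den_pos (den_pos_fstCoord (unitBall.den_pos (z : CH 5)))⟩,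
    ⟨‖sndCoord (z : CH 5)‖⁻¹ • sndCoord (z : CH 5),
      mem_sphere_zero_iff_norm.2 (norm_smul_inv_norm (𝕜 := ℝ) (sndCoord_ne_zero z))⟩),
    ⟨distToCH2 (z : CH 5), Real.arsinh_pos_iff.2 (Real.sqrt_pos.2
      (sinhSqDist_pos (unitBall.den_pos (z : CH 5)) (sndCoord_ne_zero z)))⟩)

theorem normalExpCH_normalCoords (z : chCompl) : normalExpCH (normalCoords z) = z :=
  Subtype.ext (Subtype.ext
    (normalExp_coords (unitBall.den_pos (z : CH 5)) (sndCoord_ne_zero z)))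

theorem normalCoords_normalExpCH (p : (CH 2 × S5) × halfLine) :
    normalCoords (normalExpCH p) = p := by
  obtain ⟨⟨q, W⟩, r⟩ := p
  have hr : (0 : ℝ) < r := r.2
  have hs := Real.sinh_pos_iff.2 hr
  have hc := Real.cosh_pos (r : ℝ)
  have hq := unitBall.den_pos q
  have hsq := Real.sqrt_pos.2 hq
  refine Prod.ext (Prod.ext (Subtype.ext ?_) (Subtype.ext ?_)) (Subtype.ext ?_)
  · exact fstCoord_joinCoord _ _
  · change ‖sndCoord (normalExp ((q, W), r))‖⁻¹ • sndCoord (normalExp ((q, W), r)) = (W : V 3)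
    rw [norm_sndCoord_normalExp _ (norm_S5 W) hr.le, normalExp, sndCoord_joinCoord, smul_smul,
      inv_mul_cancel₀ (by positivity), one_smul]
  · exact distToCH2_normalExp hq (norm_S5 W) hr.le

/-- The ambient coordinates of `(ℂℍ² × S⁵) × (0, ∞)`. -/
def ambientCoords (p : (CH 2 × S5) × halfLine) : (V 2 × V 3) × ℝ := ((p.1.1, p.1.2), p.2)

theorem contMDiff_ambientCoords : ContMDiff ((𝓘(ℝ, V 2).prod (𝓡 5)).prod 𝓘(ℝ, ℝ))
    𝓘(ℝ, (V 2 × V 3) × ℝ) ∞ ambientCoords := by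
  refine ((ContMDiff.prodMk_space ?_ ?_).prodMk_space ?_)
  · exact contMDiff_subtype_val.comp (contMDiff_fst.comp contMDiff_fst)
  · exact contMDiff_coe_sphere.comp (contMDiff_snd.comp contMDiff_fst)
  · exact contMDiff_subtype_val.comp contMDiff_snd

theorem contMDiff_normalExpCH_coe : ContMDiff ((𝓘(ℝ, V 2).prod (𝓡 5)).prod 𝓘(ℝ, ℝ)) 𝓘(ℝ, V 5) ∞
    (fun p ↦ (normalExpCH p : CH 5)) := by
  rw [← ContMDiff.subtypeVal_comp_iff]
  intro p
  exact ContMDiffAt.comp (f := ambientCoords) p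
    (contDiffAt_normalExp (unitBall.den_pos p.1.1) _ _).contMDiffAt (contMDiff_ambientCoords p)

theorem contMDiff_normalExpCH : ContMDiff ((𝓘(ℝ, V 2).prod (𝓡 5)).prod 𝓘(ℝ, ℝ)) 𝓘(ℝ, V 5) ∞
    normalExpCH :=
  (ContMDiff.subtypeVal_comp_iff _ _).1 contMDiff_normalExpCH_coe

theorem contMDiff_normalCoords : ContMDiff 𝓘(ℝ, V 5) ((𝓘(ℝ, V 2).prod (𝓡 5)).prod 𝓘(ℝ, ℝ)) ∞
    normalCoords := by
  have hval : ContMDiff 𝓘(ℝ, V 5) 𝓘(ℝ, V 5) ∞ (fun z : chCompl ↦ ((z : CH 5) : V 5)) :=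
    contMDiff_subtype_val.comp contMDiff_subtype_val
  have hpull {E : Type} [NormedAddCommGroup E] [NormedSpace ℝ E] {g : V 5 → E}
      (hg : ∀ z : chCompl, ContDiffAt ℝ ∞ g (z : CH 5)) :
      ContMDiff 𝓘(ℝ, V 5) 𝓘(ℝ, E) ∞ (fun z : chCompl ↦ g (z : CH 5)) :=
    fun z ↦ (hg z).contMDiffAt.comp z (hval z)
  refine ContMDiff.prodMk (ContMDiff.prodMk ?_ ?_) ?_
  · rw [← ContMDiff.subtypeVal_comp_iff]
    exact hpull fun z ↦ fstCoord.contDiff.contDiffAt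
  · refine ContMDiff.codRestrict_sphere (hpull
      (g := fun z ↦ ‖sndCoord z‖⁻¹ • sndCoord z) fun z ↦ ?_) _
    exact (((contDiffAt_norm ℂ (sndCoord_ne_zero z)).comp _ sndCoord.contDiff.contDiffAt).inv
      (norm_ne_zero_iff.2 (sndCoord_ne_zero z))).smul sndCoord.contDiff.contDiffAt
  · rw [← ContMDiff.subtypeVal_comp_iff]
    refine hpull (g := distToCH2) fun z ↦ ?_
    -- The square root is smooth here because `S > 0` off `ℂℍ²`.
    refine Real.contDiff_arsinh.contDiffAt.comp _ (ContDiffAt.sqrt ?_ ?_)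
    · exact contDiffOn_sinhSqDist.contDiffAt (Metric.isOpen_ball.mem_nhds (z : CH 5).2)
    · exact (sinhSqDist_pos (unitBall.den_pos (z : CH 5)) (sndCoord_ne_zero z)).ne'

/-- The normal exponential map of `ℂℍ²` as a diffeomorphism onto `ℂℍ⁵ \ ℂℍ²`. -/
def normalDiffeo : Diffeomorph ((𝓘(ℝ, V 2).prod (𝓡 5)).prod 𝓘(ℝ, ℝ)) 𝓘(ℝ, V 5)
    ((CH 2 × S5) × halfLine) chCompl ∞ where
  toFun := normalExpCH
  invFun := normalCoords
  left_inv := normalCoords_normalExpCH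
  right_inv := normalExpCH_normalCoords
  contMDiff_toFun := contMDiff_normalExpCH
  contMDiff_invFun := contMDiff_normalCoords

/-! ### The differential on the manifold -/

/-- The tangent space of the sphere at `W` is the real orthogonal complement of `W`; this supplies
the orthogonality hypotheses of `chForm_normal`. -/
theorem re_inner_toVec {W : S5} (w : TangentSpace (𝓡 5) W) :
    (inner ℂ (W : V 3) (S5.toVec w)).re = 0 := by
  have h : S5.toVec w ∈ (Submodule.span ℝ {(W : V 3)})ᗮ := by
    rw [← range_mvfderiv_subtypeVal (n := 5) W]
    exact ⟨w, rfl⟩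
  exact Submodule.mem_orthogonal_singleton_iff_inner_right.1 h

theorem mfderiv_ambientCoords (q : CH 2) (W : S5) (r : halfLine) (u : V 2)
    (w : TangentSpace (𝓡 5) W) (ρ : ℝ) :
    mfderiv ((𝓘(ℝ, V 2).prod (𝓡 5)).prod 𝓘(ℝ, ℝ)) 𝓘(ℝ, (V 2 × V 3) × ℝ) ambientCoords
      ((q, W), r) ((u, w), ρ) = ((u, S5.toVec w), ρ) := by
  have h1 : HasMFDerivAt ((𝓘(ℝ, V 2).prod (𝓡 5)).prod 𝓘(ℝ, ℝ)) 𝓘(ℝ, V 2)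
      (fun p : (CH 2 × S5) × halfLine ↦ (p.1.1 : V 2)) ((q, W), r) _ :=
    (hasMFDerivAt_opens_val _ q).comp ((q, W), r)
      ((hasMFDerivAt_fst (q, W)).comp ((q, W), r) (hasMFDerivAt_fst ((q, W), r)))
  have h2 : HasMFDerivAt ((𝓘(ℝ, V 2).prod (𝓡 5)).prod 𝓘(ℝ, ℝ)) 𝓘(ℝ, V 3)
      (fun p : (CH 2 × S5) × halfLine ↦ (p.1.2 : V 3)) ((q, W), r) _ :=
    ((contMDiff_coe_sphere (m := 1) W).mdifferentiableAt one_ne_zero).hasMFDerivAt.comp ((q, W), r)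
      ((hasMFDerivAt_snd (q, W)).comp ((q, W), r) (hasMFDerivAt_fst ((q, W), r)))
  have h3 : HasMFDerivAt ((𝓘(ℝ, V 2).prod (𝓡 5)).prod 𝓘(ℝ, ℝ)) 𝓘(ℝ, ℝ)
      (fun p : (CH 2 × S5) × halfLine ↦ (p.2 : ℝ)) ((q, W), r) _ :=
    (hasMFDerivAt_opens_val _ r).comp ((q, W), r) (hasMFDerivAt_snd ((q, W), r))
  have h : HasMFDerivAt ((𝓘(ℝ, V 2).prod (𝓡 5)).prod 𝓘(ℝ, ℝ)) 𝓘(ℝ, (V 2 × V 3) × ℝ)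
      ambientCoords ((q, W), r) _ :=
    ⟨(h1.1.prodMk h2.1).prodMk h3.1, (h1.2.prodMk h2.2).prodMk h3.2⟩
  rw [h.mfderiv]
  rfl

theorem mfderiv_normalExpCH (q : CH 2) (W : S5) (r : halfLine) (u : V 2)
    (w : TangentSpace (𝓡 5) W) (ρ : ℝ) :
    (mfderiv ((𝓘(ℝ, V 2).prod (𝓡 5)).prod 𝓘(ℝ, ℝ)) 𝓘(ℝ, V 5)
      (fun p ↦ (normalExpCH p : CH 5)) ((q, W), r) ((u, w), ρ) : V 5)
      = joinCoord (u, (Real.sqrt (1 - ‖(q : V 2)‖ ^ 2) * (ρ / Real.cosh r ^ 2)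
          - (inner ℂ (q : V 2) u).re / Real.sqrt (1 - ‖(q : V 2)‖ ^ 2)
            * (Real.sinh r / Real.cosh r)) • (W : V 3)
        + (Real.sqrt (1 - ‖(q : V 2)‖ ^ 2) * (Real.sinh r / Real.cosh r)) • S5.toVec w) := by
  obtain ⟨D, hD, hDv⟩ := hasFDerivAt_normalExp (unitBall.den_pos q) (W : V 3) (r : ℝ)
  refine (mfderiv_opens_eq_mfderiv_val
    (contMDiff_normalExpCH_coe.mdifferentiableAt (by simp)) _).trans ?_
  have h := HasMFDerivAt.comp (f := ambientCoords) ((q, W), r) hD.hasMFDerivAt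
    ((contMDiff_ambientCoords _).mdifferentiableAt (by simp)).hasMFDerivAt
  refine (DFunLike.congr_fun h.mfderiv _).trans ?_
  refine (congrArg D (mfderiv_ambientCoords q W r u w ρ)).trans (hDv u _ ρ)

end

/-- `ℂℍ⁵ \ ℂℍ²` is diffeomorphic to `(ℂℍ² × S⁵) × (0, ∞)`, with `r` the distance to `ℂℍ²` and `q` a
nearest point of `ℂℍ²`, in such a way that
`c_5 = cosh² r c_2 + sinh² r p_2 + ¼ sinh² (2 r) dθ² + dr²`. -/
theorem mainTheorem8 :
    ∃ Φ : Diffeomorph ((𝓘(ℝ, V 2).prod (𝓡 5)).prod 𝓘(ℝ, ℝ)) 𝓘(ℝ, V 5)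
        ((CH 2 × S5) × halfLine) chCompl ∞,
      ∀ (q : CH 2) (W : S5) (r : halfLine),
        chDist (Φ ((q, W), r) : CH 5) (chIncl q)
            = ENNReal.ofReal (r : ℝ) ∧
        (∀ y : CH 2, ENNReal.ofReal (r : ℝ)
            ≤ chDist (Φ ((q, W), r) : CH 5) (chIncl y)) ∧
        ∀ (u u' : TangentSpace 𝓘(ℝ, V 2) q) (w w' : TangentSpace (𝓡 5) W)
          (ρ ρ' : ℝ),
          (chMetric 5).inner (Φ ((q, W), r) : CH 5)
              (mfderiv ((𝓘(ℝ, V 2).prod (𝓡 5)).prod 𝓘(ℝ, ℝ)) 𝓘(ℝ, V 5)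
                (fun p ↦ (Φ p : CH 5)) ((q, W), r) ((u, w), ρ))
              (mfderiv ((𝓘(ℝ, V 2).prod (𝓡 5)).prod 𝓘(ℝ, ℝ)) 𝓘(ℝ, V 5)
                (fun p ↦ (Φ p : CH 5)) ((q, W), r) ((u', w'), ρ'))
            = Real.cosh r ^ 2 * (chMetric 2).inner q u u'
              + Real.sinh r ^ 2 * p2 W w w'
              + 1 / 4 * Real.sinh (2 * r) ^ 2 * (dTheta q W u w * dTheta q W u' w')
              + ρ * ρ' := by
  refine ⟨normalDiffeo, fun q W r ↦ ?_⟩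
  have hr : (0 : ℝ) ≤ r := le_of_lt r.2
  -- Used twice: as the nearest-point property, and at `y = q` as half of the distance equality.
  have hlow (y : CH 2) : ENNReal.ofReal (r : ℝ)
      ≤ chDist (normalDiffeo ((q, W), r) : CH 5) (chIncl y) := by
    refine le_trans (le_of_eq ?_) (le_chDist_chIncl _ y)
    exact congrArg ENNReal.ofReal
      (distToCH2_normalExp (unitBall.den_pos q) (norm_S5 W) hr).symm
  refine ⟨le_antisymm (chDist_normalExp_le q (norm_S5 W) hr _ rfl) (hlow q), hlow,
    fun u u' w w' ρ ρ' ↦ ?_⟩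
  have h := chForm_normal (unitBall.den_pos q) (norm_S5 W) r u u' (re_inner_toVec w)
    (re_inner_toVec w') ρ ρ' rfl rfl
  rw [← mfderiv_normalExpCH q W r u w ρ, ← mfderiv_normalExpCH q W r u' w' ρ'] at h
  exact h
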